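/- A finite tree MDP has finite sets $\mathcal S$ (non-terminal states, containing a root $s_1$), $\Sigma$ (terminal states) and $\mathcal A$ (actions), a horizon $\mathcal H\ge 1$, a discount factor $\gamma\in[0,1]$, transition probabilities $p(s,a,s')$ and known rewards $r(s,a,s')$. The nodes $\mathcal S\cup\Sigma$ form a tree with root $s_1$ at level $1$: every other node has exactly one parent state $s$ and exactly one action $a$ leading from $s$ to it, $p(s,a,\cdot)$ is a probability distribution on the children of $s$ under $a$, and non-terminal states have levels at most $\mathcal H$. If $s_1,a_1,\dots,s_m,a_m,s_{m+1}=\sigma$ is the path to $\sigma\in\Sigma$, put $\rho(\sigma)=\sum_{i=1}^m\gamma^{i-1}r(s_i,a_i,s_{i+1})$, and assume $\rho(\sigma)\in[0,1]$ for all $\sigma$. Let $\Pi=\mathcal A^{\mathcal S}$ be the set of deterministic policies. A policy $\pi$ is consistent with $\sigma$ if $\pi(s_i)=a_i$ for all $i\le m$; let $X(\pi)$ be the set of terminal states with which $\pi$ is consistent, and $Y(\sigma)$ the set of policies consistent with $\sigma$. Let $V(\pi)=V^\pi(s_1)$, where $V^\pi$ solves the Bellman equation $V^\pi(s)=\sum_{s'}p(s,\pi(s),s')\,(r(s,\pi(s),s')+\gamma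 V^\pi(s'))$ with $V^\pi=0$ on $\Sigma$. Let $V^\star=\max_{\pi\in\Pi} V(\pi)$, $\Pi_{\rm opt}=\{\pi\in\Pi:V(\pi)=V^\star\}$ and $\Delta_\pi=V^\star-V(\pi)$. For $\sigma$ with $Y(\sigma)\not\subseteq\Pi_{\rm opt}$ let $\Delta^{\min}_\sigma$ and $\Delta^{\max}_\sigma$ be the minimum and the maximum of $\Delta_\pi$ over $\pi\in Y(\sigma)\setminus\Pi_{\rm opt}$. A learner that does not know $p$ plays a policy $\pi^t$ in each episode $t=1,2,\dots$, which runs from $s_1$ to a terminal state. Before episode $t$, let $n^t(\sigma)$ be the number of past episodes whose policy was consistent with $\sigma$, let $n^t_+(\sigma)$ be the number of past episodes that reached $\sigma$, and put $n^t(\pi)=\min_{\sigma\in X(\pi)}n^t(\sigma)$, $\delta_U(t)=1/(|\Pi|\,t^{|\Sigma|+4})$ and $$\mathrm{ucb}^t(\pi)=\sum_{\sigma\in X(\pi)}\frac{n^t_+(\sigma)}{n^t(\sigma)}\rho(\sigma)+\sqrt{\frac{8}{3\,n^t(\pi)}\ln\frac1{\delta_U(t)}}.$$ Ucb-T plays,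 if some $\sigma$ has $n^t(\sigma)=0$, an arbitrary policy in $Y(\sigma)$ for such a $\sigma$, and otherwise a policy maximising $\mathrm{ucb}^t$ over $\Pi$ (ties broken arbitrarily). Its regret is $R_T=\sum_{t=1}^T\left(V^\star-\mathbb E[V(\pi^t)]\right)$. Theorem. There is an absolute constant $c>0$ such that for every finite tree MDP as above, every implementation of Ucb-T and every $T\ge2$, $$R_T\le c\sum_{\sigma\in\Sigma,\ Y(\sigma)\not\subseteq\Pi_{\rm opt}}\left(\frac{|\Sigma|\,\Delta^{\max}_\sigma}{(\Delta^{\min}_\sigma)^2}\ln T+\ln|\Pi|\right).$$ -/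

import Mathlib

/-- A finite tree-structured Markov decision process with non-terminal states `S`, terminal
states `L` and actions `A`.  A node of the tree is an element of `S ⊕ L`.  Every node except
the root has exactly one parent state, reached from it through exactly one action, and all
transitions go from a node to one of its children in the tree. -/
structure TreeMDP (S L A : Type*) where
  /-- the starting state -/
  root : S
  /-- the horizon -/
  horizon : ℕ
  /-- the discount factor -/
  disc : ℝ
  disc_nonneg : 0 ≤ disc
  disc_le_one : disc ≤ 1
  /-- the transition probabilities: `p s a x` is the probability of moving to `x` -/
  p : S → A → PMF (S ⊕ L)
  /-- the (known) rewards -/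
  r : S → A → S ⊕ L → ℝ
  /-- the parent state of a node, and the action leading from that state to the node -/
  parent : S ⊕ L → Option (S × A)
  /-- the level of a non-terminal state -/
  level : S → ℕ
  parent_eq_none : ∀ x, parent x = none ↔ x = Sum.inl root
  parent_of_p : ∀ s a x, x ∈ (p s a).support → parent x = some (s, a)
  level_root : level root = 1
  level_child : ∀ s a s', parent (Sum.inl s') = some (s, a) → level s' = level s + 1
  level_le : ∀ s, level s ≤ horizon

namespace TreeMDP

/-- Deterministic policies. -/
abbrev Policy (S A : Type*) := S → A

/-- The record of one episode: the policy played, and the state in which the episode ended.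
In a tree this state determines the whole trajectory. -/
abbrev Play (S L A : Type*) := (S → A) × (S ⊕ L)

/-- A (possibly randomised) learning algorithm: the law of the next policy, given the records of
the preceding `k` episodes. -/
abbrev Learner (S L A : Type*) := (k : ℕ) → (Fin k → Play S L A) → PMF (Policy S A)

variable {S L A : Type*}

/-! ### Paths, returns and consistency -/

/-- The last (at most `n`) transitions `(s, a, s')` of the path from the root to a node. -/
def pathAux (M : TreeMDP S L A) : ℕ → S ⊕ L → List (S × A × (S ⊕ L))
  | 0, _ => []
  | n + 1, x =>
    match M.parent x with
    | none => []
    | some (s, a) => pathAux M n (Sum.inl s) ++ [(s, a, x)]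

/-- The transitions on the path from the root to the terminal state `σ`, in order.  Such a path
has at most `horizon` transitions. -/
def path (M : TreeMDP S L A) (σ : L) : List (S × A × (S ⊕ L)) :=
  M.pathAux M.horizon (Sum.inr σ)

/-- The discounted cumulative reward `ρ(σ)` along the path to the terminal state `σ`. -/
noncomputable def ret (M : TreeMDP S L A) (σ : L) : ℝ :=
  ((M.path σ).mapIdx fun i e => M.disc ^ i * M.r e.1 e.2.1 e.2.2).sum

/-- `π` takes the actions of the path to `σ`. -/
def Consistent (M : TreeMDP S L A) (π : Policy S A) (σ : L) : Prop :=
  ∀ e ∈ M.path σ, π e.1 = e.2.1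

/-- The terminal states with which `π` is consistent. -/
def X (M : TreeMDP S L A) (π : Policy S A) : Set L := {σ | M.Consistent π σ}

/-- The policies that are consistent with `σ`. -/
def Y (M : TreeMDP S L A) (σ : L) : Set (Policy S A) := {π | M.Consistent π σ}

/-! ### Values -/

/-- Bottom-up evaluation of a policy, over `n` steps. -/
noncomputable def valueAux [Fintype S] [Fintype L] (M : TreeMDP S L A) (π : Policy S A) :
    ℕ → S ⊕ L → ℝ
  | 0, _ => 0
  | _ + 1, Sum.inr _ => 0
  | n + 1, Sum.inl s =>
    ∑ x, (M.p s (π s) x).toReal * (M.r s (π s) x + M.disc * valueAux M π n x)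

/-- The value `V^π(s)`, extended by `0` to terminal states. -/
noncomputable def stateValue [Fintype S] [Fintype L] (M : TreeMDP S L A) (π : Policy S A)
    (x : S ⊕ L) : ℝ :=
  M.valueAux π M.horizon x

/-- The value `V(π)` of a policy at the starting state. -/
noncomputable def value [Fintype S] [Fintype L] (M : TreeMDP S L A) (π : Policy S A) : ℝ :=
  M.stateValue π (Sum.inl M.root)

theorem valueAux_inr [Fintype S] [Fintype L] (M : TreeMDP S L A) (π : Policy S A) (n : ℕ)
    (σ : L) : M.valueAux π n (Sum.inr σ) = 0 := by
  cases n <;> rfl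

theorem one_le_level (M : TreeMDP S L A) (s : S) : 1 ≤ M.level s := by
  rcases h : M.parent (Sum.inl s) with _ | ⟨s', a⟩
  · have h2 := (M.parent_eq_none _).1 h
    rw [Sum.inl.injEq] at h2
    rw [h2, M.level_root]
  · rw [M.level_child _ _ _ h]
    omega

theorem valueAux_succ [Fintype S] [Fintype L] (M : TreeMDP S L A) (π : Policy S A) :
    ∀ (n : ℕ) (s : S), M.horizon < n + M.level s →
      M.valueAux π (n + 1) (Sum.inl s) = M.valueAux π n (Sum.inl s) := by
  intro n
  induction n with
  | zero => intro s hs; have := M.level_le s; omega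
  | succ n ih =>
    intro s hs
    rw [valueAux, valueAux]
    refine Finset.sum_congr rfl fun x _ => ?_
    by_cases hx : M.p s (π s) x = 0
    · simp [hx]
    · rcases x with s' | σ
      · have hp := M.parent_of_p s (π s) _ ((PMF.mem_support_iff _ _).2 hx)
        have hl := M.level_child _ _ _ hp
        rw [ih s' (by omega)]
      · simp [valueAux_inr]

/-- The Bellman equation. -/
theorem stateValue_inl [Fintype S] [Fintype L] (M : TreeMDP S L A) (π : Policy S A) (s : S) :
    M.stateValue π (Sum.inl s) =
      ∑ x, (M.p s (π s) x).toReal * (M.r s (π s) x + M.disc * M.stateValue π x) := by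
  have h1 := M.one_le_level s
  unfold stateValue
  rw [← M.valueAux_succ π M.horizon s (by omega), valueAux]

theorem stateValue_inr [Fintype S] [Fintype L] (M : TreeMDP S L A) (π : Policy S A) (σ : L) :
    M.stateValue π (Sum.inr σ) = 0 :=
  M.valueAux_inr π _ σ

/-- The optimal value, a maximum when there are finitely many (and some) policies. -/
noncomputable def optValue [Fintype S] [Fintype L] (M : TreeMDP S L A) : ℝ :=
  ⨆ π : Policy S A, M.value π

/-- The optimal policies: those of maximal value at the starting state. -/
def Opt [Fintype S] [Fintype L] (M : TreeMDP S L A) : Set (Policy S A) :=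
  {π | ∀ π', M.value π' ≤ M.value π}

/-- The gap of a policy. -/
noncomputable def gap [Fintype S] [Fintype L] (M : TreeMDP S L A) (π : Policy S A) : ℝ :=
  M.optValue - M.value π

/-- The smallest gap of a non-optimal policy consistent with `σ` (only used when there is one). -/
noncomputable def gapMin [Fintype S] [Fintype L] (M : TreeMDP S L A) (σ : L) : ℝ :=
  ⨅ π : ↥(M.Y σ \ M.Opt), M.gap π

/-- The largest gap of a non-optimal policy consistent with `σ` (only used when there is one). -/
noncomputable def gapMax [Fintype S] [Fintype L] (M : TreeMDP S L A) (σ : L) : ℝ :=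
  ⨆ π : ↥(M.Y σ \ M.Opt), M.gap π

/-! ### Interaction with the environment -/

/-- One step of the environment under `π`; terminal states are absorbing. -/
noncomputable def step (M : TreeMDP S L A) (π : Policy S A) : S ⊕ L → PMF (S ⊕ L)
  | Sum.inl s => M.p s (π s)
  | Sum.inr σ => PMF.pure (Sum.inr σ)

/-- The law of the state after `n` steps of an episode under `π`. -/
noncomputable def run (M : TreeMDP S L A) (π : Policy S A) : ℕ → PMF (S ⊕ L)
  | 0 => PMF.pure (Sum.inl M.root)
  | n + 1 => (run M π n).bind (M.step π)

/-- The law of the state in which an episode under `π` ends.  It is carried by the terminal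
states, since every episode ends within `horizon` steps. -/
noncomputable def outcome (M : TreeMDP S L A) (π : Policy S A) : PMF (S ⊕ L) :=
  M.run π M.horizon

/-- The joint law of the records of the first `k` episodes. -/
noncomputable def history (M : TreeMDP S L A) (alg : Learner S L A) :
    (k : ℕ) → PMF (Fin k → Play S L A)
  | 0 => PMF.pure Fin.elim0
  | k + 1 =>
    (history M alg k).bind fun h =>
      (alg k h).bind fun π =>
        (M.outcome π).map fun x => Fin.snoc (α := fun _ => Play S L A) h (π, x)

/-- The law of the policy played after `k` episodes, that is, on episode `k + 1`. -/
noncomputable def policyLaw (M : TreeMDP S L A) (alg : Learner S L A) (k : ℕ) :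
    PMF (Policy S A) :=
  (M.history alg k).bind (alg k)

/-- The regret over `T` episodes. -/
noncomputable def regret [Fintype S] [DecidableEq S] [Fintype L] [Fintype A]
    (M : TreeMDP S L A) (alg : Learner S L A) (T : ℕ) : ℝ :=
  ∑ k ∈ Finset.range T,
    (M.optValue - ∑ π : Policy S A, (M.policyLaw alg k π).toReal * M.value π)

/-! ### The algorithm -/

open Classical in
/-- The number of past episodes in which the policy played was consistent with `σ`. -/
noncomputable def count (M : TreeMDP S L A) {k : ℕ} (h : Fin k → Play S L A) (σ : L) : ℕ :=
  (Finset.univ.filter fun i => M.Consistent (h i).1 σ).card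

open Classical in
/-- The number of past episodes that reached `σ`. -/
noncomputable def hits {k : ℕ} (h : Fin k → Play S L A) (σ : L) : ℕ :=
  (Finset.univ.filter fun i => (h i).2 = Sum.inr σ).card

/-- The play count of a policy: the smallest count among the terminal states consistent
with it (there is always one). -/
noncomputable def polCount (M : TreeMDP S L A) {k : ℕ} (h : Fin k → Play S L A)
    (π : Policy S A) : ℕ :=
  ⨅ σ : ↥(M.X π), M.count h σ

open Classical in
/-- The empirical value estimate of `π`. -/
noncomputable def empValue [Fintype L] (M : TreeMDP S L A) {k : ℕ} (h : Fin k → Play S L A)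
    (π : Policy S A) : ℝ :=
  ∑ σ ∈ Finset.univ.filter (fun σ => σ ∈ M.X π),
    ((hits h σ : ℝ) / (M.count h σ : ℝ)) * M.ret σ

/-- The confidence width `β(m, δ)`. -/
noncomputable def width (m : ℕ) (δ : ℝ) : ℝ :=
  Real.sqrt (8 / (3 * (m : ℝ)) * Real.log (1 / δ))

/-- The upper confidence bound of `π` for mistake probability `δ`. -/
noncomputable def ucb [Fintype L] (M : TreeMDP S L A) {k : ℕ} (h : Fin k → Play S L A)
    (π : Policy S A) (δ : ℝ) : ℝ :=
  M.empValue h π + width (M.polCount h π) δ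

/-- The mistake probability `1 / (|Π| t ^ (|Σ| + 4))` used on episode `t`. -/
noncomputable def mistake (S L A : Type*) [Fintype S] [DecidableEq S] [Fintype L] [Fintype A]
    (t : ℕ) : ℝ :=
  1 / ((Fintype.card (Policy S A) : ℝ) * (t : ℝ) ^ (Fintype.card L + 4))

/-- The policies which the algorithm may play on episode `k + 1`, given the past: if some
terminal state has not been played, an arbitrary policy consistent with such a state; otherwise
any policy with the highest upper confidence bound. -/
def UcbTChoice [Fintype S] [DecidableEq S] [Fintype L] [Fintype A] (M : TreeMDP S L A) {k : ℕ}
    (h : Fin k → Play S L A) (π : Policy S A) : Prop :=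
  (∃ σ, M.count h σ = 0 ∧ π ∈ M.Y σ) ∨
    ((∀ σ, M.count h σ ≠ 0) ∧
      ∀ π', M.ucb h π' (mistake S L A (k + 1)) ≤ M.ucb h π (mistake S L A (k + 1)))

/-- `alg` is an implementation of the algorithm: arbitrary choices and ties may be resolved in
any way, depending on the past and on extra randomness. -/
def IsUcbT [Fintype S] [DecidableEq S] [Fintype L] [Fintype A] (M : TreeMDP S L A)
    (alg : Learner S L A) : Prop :=
  ∀ (k : ℕ) (h : Fin k → Play S L A), ∀ π ∈ (alg k h).support, M.UcbTChoice h π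

end TreeMDP

/-! In a tree, the probability of reaching a terminal state `σ` is the same number `leafProb σ` for
every policy consistent with `σ`, and `0` for all others (`outcome_inr`). Hence `V(π)` is a sum of
`leafProb σ * ret σ` over consistent `σ` (`value_eq_sum`), and every episode whose policy is
consistent with `σ` is a sample for that one parameter, whatever else the policy does.

Concentration: for fixed weights `v`, the exponential of `∑ hits * v` minus a compensator
proportional to the counts has expectation at most `1` under any adaptive learner
(`expect_exp_exponent_le_one`). The weights `θ * ret σ / count σ` turn this sum into `θ` times the
empirical value, but they depend on the random counts. So the count vector is frozen at each of its
at most `k ^ |Σ|` values and a union bound is taken over vectors and policies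
(`expect_misestimated_le`). The factor `|Π| t ^ |Σ|` in the mistake probability pays for it and
leaves a summable `2 / t ^ 4`.

Regret: when nothing is misestimated, optimism forces a suboptimal policy that is played to be
consistent with a `σ` whose count is at most of order `log (1 / δ) / gap ^ 2` (`exists_count_le`).
Its gap is charged to that `σ`, which pays at most `gapMax σ` for a bounded number of plays
(`regret_le_charge`). Finally `log |Π| ≤ |Σ|` (`log_card_policy_le`), so `log (1 / δ)` is of order
`|Σ| log T`. -/

namespace TreeMDP

/-! ### Expectations over finite types. -/

section Expectation

variable {α β : Type*} [Fintype α]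

/-- The expectation of a real function under a probability mass function on a finite type. -/
noncomputable def expect (p : PMF α) (f : α → ℝ) : ℝ :=
  ∑ x, (p x).toReal * f x

theorem sum_toReal (p : PMF α) : ∑ x, (p x).toReal = 1 := by
  rw [← ENNReal.toReal_sum fun x _ => p.apply_ne_top x, ← tsum_fintype (L := .unconditional _),
    p.tsum_coe, ENNReal.toReal_one]

theorem expect_const (p : PMF α) (c : ℝ) : expect p (fun _ => c) = c := by
  rw [expect, ← Finset.sum_mul, sum_toReal, one_mul]

theorem expect_add (p : PMF α) (f g : α → ℝ) :
    expect p (fun x => f x + g x) = expect p f + expect p g := by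
  simp only [expect, mul_add, Finset.sum_add_distrib]

theorem expect_sub (p : PMF α) (f g : α → ℝ) :
    expect p (fun x => f x - g x) = expect p f - expect p g := by
  simp only [expect, mul_sub, Finset.sum_sub_distrib]

theorem expect_const_mul (p : PMF α) (c : ℝ) (f : α → ℝ) :
    expect p (fun x => c * f x) = c * expect p f := by
  simp only [expect, Finset.mul_sum, mul_left_comm]

theorem expect_sum {ι : Type*} (s : Finset ι) (p : PMF α) (f : ι → α → ℝ) :
    expect p (fun x => ∑ i ∈ s, f i x) = ∑ i ∈ s, expect p (f i) := by
  simp only [expect, Finset.mul_sum]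
  exact Finset.sum_comm

theorem expect_mono_of_support (p : PMF α) {f g : α → ℝ} (h : ∀ x ∈ p.support, f x ≤ g x) :
    expect p f ≤ expect p g := by
  refine Finset.sum_le_sum fun x _ => ?_
  by_cases hx : p x = 0
  · simp [hx]
  · exact mul_le_mul_of_nonneg_left (h x ((PMF.mem_support_iff _ _).2 hx)) ENNReal.toReal_nonneg

theorem expect_mono (p : PMF α) {f g : α → ℝ} (h : ∀ x, f x ≤ g x) : expect p f ≤ expect p g :=
  expect_mono_of_support p fun x _ => h x

theorem expect_pure (a : α) (f : α → ℝ) : expect (PMF.pure a) f = f a := by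
  classical
  rw [expect, Finset.sum_eq_single a]
  · simp
  · intro b _ hb
    simp [PMF.pure_apply, hb]
  · simp

theorem toReal_bind_apply (p : PMF α) (q : α → PMF β) (b : β) :
    (p.bind q b).toReal = ∑ a, (p a).toReal * (q a b).toReal := by
  rw [PMF.bind_apply, tsum_fintype, ENNReal.toReal_sum]
  · simp only [ENNReal.toReal_mul]
  · exact fun a _ => ENNReal.mul_ne_top (p.apply_ne_top a) ((q a).apply_ne_top b)

variable [Fintype β]

theorem expect_bind (p : PMF α) (q : α → PMF β) (f : β → ℝ) :
    expect (p.bind q) f = expect p fun a => expect (q a) f := by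
  simp only [expect, toReal_bind_apply, Finset.sum_mul, Finset.mul_sum, mul_assoc]
  exact Finset.sum_comm

theorem expect_map (p : PMF α) (g : α → β) (f : β → ℝ) :
    expect (p.map g) f = expect p fun a => f (g a) := by
  rw [← PMF.bind_pure_comp, expect_bind]
  simp only [Function.comp_apply, expect_pure]

end Expectation

/-! ### Expectations over histories of an adaptive learner. -/

section History

variable {S L A : Type*} [Fintype S] [DecidableEq S] [Fintype L] [Fintype A]

theorem expect_history_succ (M : TreeMDP S L A) (alg : Learner S L A) (k : ℕ)
    (F : (Fin (k + 1) → Play S L A) → ℝ) :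
    expect (M.history alg (k + 1)) F =
      expect (M.history alg k) fun h => expect (alg k h) fun π =>
        expect (M.outcome π) fun x => F (Fin.snoc (α := fun _ => Play S L A) h (π, x)) := by
  simp only [history, expect_bind, expect_map]

/-- Integrate out the last episode: given the past, its factor has mean at most one whichever policy
the learner chooses, so the nonnegative product is a supermartingale. -/
theorem expect_prod_history_le_one (M : TreeMDP S L A) (alg : Learner S L A)
    (f : Play S L A → ℝ) (hf : ∀ y, 0 ≤ f y)
    (h1 : ∀ π, expect (M.outcome π) (fun x => f (π, x)) ≤ 1) (k : ℕ) :
    expect (M.history alg k) (fun h => ∏ i, f (h i)) ≤ 1 := by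
  induction k with
  | zero => simp [history, expect_pure]
  | succ k ih =>
    rw [expect_history_succ]
    refine le_trans (expect_mono _ fun h => ?_) ih
    simp only [Fin.prod_univ_castSucc, Fin.snoc_castSucc, Fin.snoc_last, expect_const_mul]
    have h0 : 0 ≤ ∏ i, f (h i) := Finset.prod_nonneg fun i _ => hf _
    refine mul_le_of_le_one_right h0 ?_
    calc expect (alg k h) (fun π => expect (M.outcome π) fun x => f (π, x))
        ≤ expect (alg k h) fun _ => 1 := expect_mono _ h1
      _ = 1 := expect_const _ _

end History

/-! ### Paths, the law of an episode, and values. -/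

section Tree

variable {S L A : Type*}

/-! ### The tree -/

theorem pathAux_root (M : TreeMDP S L A) (n : ℕ) : M.pathAux n (Sum.inl M.root) = [] := by
  cases n with
  | zero => rfl
  | succ n => rw [pathAux, (M.parent_eq_none _).2 rfl]

theorem pathAux_succ_of_parent (M : TreeMDP S L A) {x : S ⊕ L} {s : S} {a : A}
    (h : M.parent x = some (s, a)) (n : ℕ) :
    M.pathAux (n + 1) x = M.pathAux n (Sum.inl s) ++ [(s, a, x)] := by
  rw [pathAux, h]

theorem eq_root_of_parent_eq_none (M : TreeMDP S L A) {s : S}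
    (h : M.parent (Sum.inl s) = none) : s = M.root :=
  Sum.inl_injective ((M.parent_eq_none _).1 h)

/-- A state of level `l` has only `l - 1` transitions above it, so any further fuel is unused. -/
theorem pathAux_succ_eq (M : TreeMDP S L A) :
    ∀ (n : ℕ) (s : S), M.level s ≤ n + 1 →
      M.pathAux (n + 1) (Sum.inl s) = M.pathAux n (Sum.inl s) := by
  intro n
  induction n with
  | zero =>
    intro s hs
    rcases h : M.parent (Sum.inl s) with _ | ⟨s', a⟩
    · rw [M.eq_root_of_parent_eq_none h, pathAux_root, pathAux_root]
    · have := M.level_child _ _ _ h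
      have := M.one_le_level s'
      omega
  | succ n ih =>
    intro s hs
    rcases h : M.parent (Sum.inl s) with _ | ⟨s', a⟩
    · rw [M.eq_root_of_parent_eq_none h, pathAux_root, pathAux_root]
    · have := M.level_child _ _ _ h
      rw [M.pathAux_succ_of_parent h, M.pathAux_succ_of_parent h, ih s' (by omega)]

theorem length_pathAux (M : TreeMDP S L A) :
    ∀ (n : ℕ) (s : S), M.level s ≤ n + 1 →
      (M.pathAux n (Sum.inl s)).length + 1 = M.level s := by
  intro n
  induction n with
  | zero =>
    intro s hs
    have := M.one_le_level s
    simp only [pathAux, List.length_nil]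
    omega
  | succ n ih =>
    intro s hs
    rcases h : M.parent (Sum.inl s) with _ | ⟨s', a⟩
    · rw [M.eq_root_of_parent_eq_none h, pathAux_root, M.level_root, List.length_nil]
    · have h1 := M.level_child _ _ _ h
      have := ih s' (by omega)
      rw [M.pathAux_succ_of_parent h, List.length_append, List.length_singleton]
      omega

theorem pathAux_horizon_of_parent (M : TreeMDP S L A) {x : S ⊕ L} {s : S} {a : A}
    (h : M.parent x = some (s, a)) :
    M.pathAux M.horizon x = M.pathAux M.horizon (Sum.inl s) ++ [(s, a, x)] := by
  have h1 := M.one_le_level s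
  have h2 := M.level_le s
  obtain ⟨H, hH⟩ : ∃ H, M.horizon = H + 1 := ⟨M.horizon - 1, by omega⟩
  rw [hH, M.pathAux_succ_of_parent h, M.pathAux_succ_eq H s (by omega)]

theorem exists_parent_inr (M : TreeMDP S L A) (σ : L) :
    ∃ s a, M.parent (Sum.inr σ) = some (s, a) := by
  rcases h : M.parent (Sum.inr σ) with _ | ⟨s, a⟩
  · exact absurd ((M.parent_eq_none _).1 h) (by simp)
  · exact ⟨s, a, rfl⟩

/-! ### The law of an episode -/

/-- The probability of following a list of transitions under `π`. -/
noncomputable def listProb (M : TreeMDP S L A) (l : List (S × A × (S ⊕ L))) : ℝ :=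
  (l.map fun e => (M.p e.1 e.2.1 e.2.2).toReal).prod

/-- The probability of reaching the terminal state `σ` under a consistent policy. -/
noncomputable def leafProb (M : TreeMDP S L A) (σ : L) : ℝ :=
  M.listProb (M.path σ)

theorem leafProb_nonneg (M : TreeMDP S L A) (σ : L) : 0 ≤ M.leafProb σ := by
  refine List.prod_nonneg fun x hx => ?_
  obtain ⟨e, -, rfl⟩ := List.mem_map.1 hx
  exact ENNReal.toReal_nonneg

open Classical in
/-- The probability of following a list of transitions under the policy `π`. -/
noncomputable def policyProb (M : TreeMDP S L A) (π : Policy S A)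
    (l : List (S × A × (S ⊕ L))) : ℝ :=
  if ∀ e ∈ l, π e.1 = e.2.1 then M.listProb l else 0

open Classical in
theorem policyProb_append_singleton (M : TreeMDP S L A) (π : Policy S A)
    (l : List (S × A × (S ⊕ L))) (s : S) (a : A) (x : S ⊕ L) :
    M.policyProb π (l ++ [(s, a, x)]) =
      M.policyProb π l * if π s = a then (M.p s a x).toReal else 0 := by
  unfold policyProb listProb
  by_cases h1 : ∀ e ∈ l, π e.1 = e.2.1
  · by_cases h2 : π s = a
    · rw [if_pos, if_pos h1, if_pos h2]
      · simp
      · intro e he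
        rcases List.mem_append.1 he with he | he
        · exact h1 e he
        · rw [List.mem_singleton.1 he]
          exact h2
    · rw [if_neg, if_neg h2, mul_zero]
      exact fun h => h2 (h (s, a, x) (by simp))
  · rw [if_neg, if_neg h1, zero_mul]
    exact fun h => h1 fun e he => h e (List.mem_append_left _ he)

-- A node can be entered only from its parent, by one action. This collapses the sum over
-- predecessors in one step of `run` to a single term.
open Classical in
theorem p_toReal_eq (M : TreeMDP S L A) (π : Policy S A) {x : S ⊕ L} {s : S} {a : A}
    (h : M.parent x = some (s, a)) (s' : S) :
    (M.p s' (π s') x).toReal =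
      if s' = s then (if π s = a then (M.p s a x).toReal else 0) else 0 := by
  by_cases h0 : M.p s' (π s') x = 0
  · rw [h0, ENNReal.toReal_zero]
    split_ifs with h1 h2
    · rw [← h2, ← h1, h0, ENNReal.toReal_zero]
    · rfl
    · rfl
  · have := M.parent_of_p s' (π s') x ((PMF.mem_support_iff _ _).2 h0)
    rw [h, Option.some.injEq, Prod.mk.injEq] at this
    rw [if_pos this.1.symm, if_pos (by rw [this.1, this.2]), this.1, ← this.2]

theorem pathAux_eq_of_level_le (M : TreeMDP S L A) (s : S) {m n : ℕ} (hm : M.level s ≤ m + 1)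
    (h : m ≤ n) : M.pathAux n (Sum.inl s) = M.pathAux m (Sum.inl s) := by
  induction n, h using Nat.le_induction with
  | base => rfl
  | succ n hn ih => rw [M.pathAux_succ_eq n s (by omega), ih]

/-- The discounted return collected on the way to a node. -/
noncomputable def nodeRet (M : TreeMDP S L A) (x : S ⊕ L) : ℝ :=
  ((M.pathAux M.horizon x).mapIdx fun i e => M.disc ^ i * M.r e.1 e.2.1 e.2.2).sum

theorem nodeRet_child (M : TreeMDP S L A) {x : S ⊕ L} {s : S} {a : A}
    (h : M.parent x = some (s, a)) :
    M.nodeRet x = M.nodeRet (Sum.inl s) + M.disc ^ (M.level s - 1) * M.r s a x := by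
  have hl := M.length_pathAux M.horizon s (by have := M.level_le s; omega)
  rw [nodeRet, M.pathAux_horizon_of_parent h, List.mapIdx_append, List.sum_append, nodeRet]
  simp [← hl]

variable [Fintype S] [Fintype L]

open Classical in
theorem run_succ_inl (M : TreeMDP S L A) (π : Policy S A) (n : ℕ) {s' s : S} {a : A}
    (h : M.parent (Sum.inl s') = some (s, a)) :
    (M.run π (n + 1) (Sum.inl s')).toReal =
      (M.run π n (Sum.inl s)).toReal * if π s = a then (M.p s a (Sum.inl s')).toReal else 0 := by
  rw [run, toReal_bind_apply, Fintype.sum_sum_type]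
  simp only [step, M.p_toReal_eq π h]
  simp

open Classical in
theorem run_succ_inr (M : TreeMDP S L A) (π : Policy S A) (n : ℕ) {σ : L} {s : S} {a : A}
    (h : M.parent (Sum.inr σ) = some (s, a)) :
    (M.run π (n + 1) (Sum.inr σ)).toReal =
      (M.run π n (Sum.inl s)).toReal * (if π s = a then (M.p s a (Sum.inr σ)).toReal else 0) +
        (M.run π n (Sum.inr σ)).toReal := by
  rw [run, toReal_bind_apply, Fintype.sum_sum_type]
  simp only [step, M.p_toReal_eq π h]
  congr 1
  · simp
  · rw [Finset.sum_eq_single σ]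
    · simp
    · intro τ _ hτ
      simp [PMF.pure_apply, Ne.symm hτ]
    · simp

theorem run_succ_root (M : TreeMDP S L A) (π : Policy S A) (n : ℕ) :
    (M.run π (n + 1) (Sum.inl M.root)).toReal = 0 := by
  rw [run, toReal_bind_apply, Fintype.sum_sum_type]
  have h : ∀ s, M.p s (π s) (Sum.inl M.root) = 0 := fun s => by
    by_contra h0
    have := M.parent_of_p s (π s) _ ((PMF.mem_support_iff _ _).2 h0)
    rw [(M.parent_eq_none _).2 rfl] at this
    cases this
  simp [step, h, PMF.pure_apply]

/-- The level rises by one at each move between non-terminal states, so `s` can be occupied only at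
time `level s - 1`. -/
theorem run_inl (M : TreeMDP S L A) (π : Policy S A) :
    ∀ (n : ℕ) (s : S), (M.run π n (Sum.inl s)).toReal =
      if M.level s = n + 1 then M.policyProb π (M.pathAux n (Sum.inl s)) else 0 := by
  classical
  intro n
  induction n with
  | zero =>
    intro s
    by_cases hs : s = M.root
    · simp [run, hs, M.level_root, policyProb, pathAux, listProb]
    · rw [if_neg]
      · simp [run, PMF.pure_apply, hs]
      · rcases h : M.parent (Sum.inl s) with _ | ⟨s', a⟩
        · exact absurd (M.eq_root_of_parent_eq_none h) hs
        · have := M.level_child _ _ _ h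
          have := M.one_le_level s'
          omega
  | succ n ih =>
    intro s
    rcases h : M.parent (Sum.inl s) with _ | ⟨s', a⟩
    · rw [M.eq_root_of_parent_eq_none h, run_succ_root, M.level_root, if_neg (by omega)]
    · have h1 := M.level_child _ _ _ h
      rw [M.run_succ_inl π n h, ih, M.pathAux_succ_of_parent h, policyProb_append_singleton, h1]
      simp only [Nat.add_right_cancel_iff]
      split_ifs <;> simp

/-- The state `σ` can be entered only at time `level s`, and it is absorbing, so its mass is
constant from then on. -/
theorem run_inr (M : TreeMDP S L A) (π : Policy S A) {σ : L} {s : S} {a : A}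
    (h : M.parent (Sum.inr σ) = some (s, a)) (n : ℕ) :
    (M.run π n (Sum.inr σ)).toReal =
      if M.level s ≤ n then M.policyProb π (M.path σ) else 0 := by
  classical
  have hl := M.one_le_level s
  induction n with
  | zero =>
    rw [if_neg (by omega)]
    simp [run, PMF.pure_apply]
  | succ n ih =>
    rw [M.run_succ_inr π n h, ih, run_inl]
    rcases lt_trichotomy (M.level s) (n + 1) with h1 | h1 | h1
    · rw [if_neg h1.ne, if_pos (show M.level s ≤ n by omega), if_pos h1.le, zero_mul, zero_add]
    · have h2 := M.level_le s
      rw [if_pos h1, if_neg (show ¬ M.level s ≤ n by omega), if_pos h1.le, add_zero, path,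
        M.pathAux_horizon_of_parent h, policyProb_append_singleton,
        M.pathAux_eq_of_level_le s (m := n) (n := M.horizon) (by omega) (by omega)]
    · rw [if_neg h1.ne', if_neg (show ¬ M.level s ≤ n by omega), if_neg h1.not_ge, zero_mul, zero_add]

open Classical in
theorem outcome_inr (M : TreeMDP S L A) (π : Policy S A) (σ : L) :
    (M.outcome π (Sum.inr σ)).toReal = if M.Consistent π σ then M.leafProb σ else 0 := by
  obtain ⟨s, a, h⟩ := M.exists_parent_inr σ
  rw [outcome, M.run_inr π h, if_pos (M.level_le s), policyProb]
  exact if_congr Iff.rfl rfl rfl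

theorem outcome_inl (M : TreeMDP S L A) (π : Policy S A) (s : S) :
    (M.outcome π (Sum.inl s)).toReal = 0 := by
  have := M.level_le s
  rw [outcome, run_inl, if_neg (by omega)]

open Classical in
theorem expect_outcome (M : TreeMDP S L A) (π : Policy S A) (f : S ⊕ L → ℝ) :
    expect (M.outcome π) f =
      ∑ σ, if M.Consistent π σ then M.leafProb σ * f (Sum.inr σ) else 0 := by
  rw [expect, Fintype.sum_sum_type]
  simp only [outcome_inl, outcome_inr, zero_mul, Finset.sum_const_zero, zero_add, ite_mul]

open Classical in
theorem sum_leafProb (M : TreeMDP S L A) (π : Policy S A) :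
    ∑ σ, (if M.Consistent π σ then M.leafProb σ else 0) = 1 := by
  have := M.expect_outcome π fun _ => 1
  rw [expect_const] at this
  simpa using this.symm

theorem exists_consistent (M : TreeMDP S L A) (π : Policy S A) : ∃ σ, M.Consistent π σ := by
  classical
  by_contra! h
  have := M.sum_leafProb π
  simp [h] at this

/-! ### The value as an expected return -/

/-- The conditional expectation of the return, given that a node is visited. -/
noncomputable def potential (M : TreeMDP S L A) (π : Policy S A) : S ⊕ L → ℝ
  | Sum.inl s => M.nodeRet (Sum.inl s) + M.disc ^ (M.level s - 1) * M.stateValue π (Sum.inl s)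
  | Sum.inr σ => M.nodeRet (Sum.inr σ)

theorem potential_child (M : TreeMDP S L A) (π : Policy S A) {x : S ⊕ L} {s : S} {a : A}
    (h : M.parent x = some (s, a)) :
    M.potential π x = M.nodeRet (Sum.inl s) +
      M.disc ^ (M.level s - 1) * (M.r s a x + M.disc * M.stateValue π x) := by
  rcases x with s' | σ
  · have h1 := M.level_child _ _ _ h
    have h2 := M.one_le_level s
    rw [potential, M.nodeRet_child h, h1, show M.level s + 1 - 1 = M.level s - 1 + 1 by omega]
    ring
  · rw [potential, M.nodeRet_child h, stateValue_inr]
    ring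

/-- The Bellman equation says exactly that return collected so far plus discounted value to go is a
martingale along the episode. -/
theorem expect_step_potential (M : TreeMDP S L A) (π : Policy S A) (x : S ⊕ L) :
    expect (M.step π x) (M.potential π) = M.potential π x := by
  rcases x with s | σ
  · rw [potential, stateValue_inl, Finset.mul_sum]
    calc expect (M.p s (π s)) (M.potential π)
        = expect (M.p s (π s)) fun x => M.nodeRet (Sum.inl s) +
            M.disc ^ (M.level s - 1) * (M.r s (π s) x + M.disc * M.stateValue π x) := by
          refine le_antisymm ?_ ?_ <;>
          · refine expect_mono_of_support _ fun x hx => ?_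
            rw [M.potential_child π (M.parent_of_p _ _ _ hx)]
      _ = _ := by
          rw [expect_add, expect_const, expect_const_mul, expect, Finset.mul_sum]
  · exact expect_pure _ _

theorem expect_run_potential (M : TreeMDP S L A) (π : Policy S A) (n : ℕ) :
    expect (M.run π n) (M.potential π) = M.value π := by
  induction n with
  | zero => simp [run, expect_pure, potential, nodeRet, pathAux_root, M.level_root, value]
  | succ n ih => simp only [run, expect_bind, expect_step_potential, ih]

-- The martingale starts at `V(π)` and ends, at the horizon, at the return of the terminal state
-- reached.
open Classical in
theorem value_eq_sum (M : TreeMDP S L A) (π : Policy S A) :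
    M.value π = ∑ σ, if M.Consistent π σ then M.leafProb σ * M.ret σ else 0 := by
  rw [← M.expect_run_potential π M.horizon]
  exact M.expect_outcome π _

theorem value_mem_Icc (M : TreeMDP S L A) (hret : ∀ σ, M.ret σ ∈ Set.Icc (0 : ℝ) 1)
    (π : Policy S A) : M.value π ∈ Set.Icc (0 : ℝ) 1 := by
  classical
  rw [value_eq_sum]
  constructor
  · refine Finset.sum_nonneg fun σ _ => ?_
    split_ifs
    · exact mul_nonneg (M.leafProb_nonneg σ) (hret σ).1
    · exact le_rfl
  · rw [← M.sum_leafProb π]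
    refine Finset.sum_le_sum fun σ _ => ?_
    split_ifs
    · exact mul_le_of_le_one_right (M.leafProb_nonneg σ) (hret σ).2
    · exact le_rfl

/-! ### Counting terminal states -/

/-- Each pair `(s, a)` has a child, since `p s a` has nonempty support. The parent map recovers the
pair, so these children and the root are distinct nodes. -/
theorem card_mul_card_lt (M : TreeMDP S L A) [Fintype A] :
    Fintype.card S * Fintype.card A + 1 ≤ Fintype.card S + Fintype.card L := by
  choose c hc using fun sa : S × A => (M.p sa.1 sa.2).support_nonempty
  have hp : ∀ sa, M.parent (c sa) = some sa := fun sa => M.parent_of_p _ _ _ (hc sa)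
  let f : Option (S × A) → S ⊕ L := fun o => o.elim (Sum.inl M.root) c
  have hf : ∀ o, M.parent (f o) = o := by
    rintro (_ | sa)
    · exact (M.parent_eq_none _).2 rfl
    · exact hp sa
  have := Fintype.card_le_of_injective f (Function.LeftInverse.injective hf)
  simpa using this

/-- Combine `log |A| ≤ |A| - 1` with the node count: `|S| * (|A| - 1) ≤ |L| - 1`. -/
theorem log_card_policy_le (M : TreeMDP S L A) [DecidableEq S] [Fintype A] [Nonempty A] :
    Real.log (Fintype.card (Policy S A)) ≤ Fintype.card L := by
  have h1 : (Fintype.card S * Fintype.card A + 1 : ℝ) ≤ Fintype.card S + Fintype.card L := by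
    exact_mod_cast M.card_mul_card_lt
  have hA : (0 : ℝ) < Fintype.card A := by exact_mod_cast Fintype.card_pos
  have h2 := mul_le_mul_of_nonneg_left (Real.log_le_sub_one_of_pos hA)
    (Nat.cast_nonneg (α := ℝ) (Fintype.card S))
  rw [Fintype.card_fun, Nat.cast_pow, Real.log_pow]
  linarith

end Tree

/-! ### Concentration of empirical values under adaptive play. -/

section Concentration

variable {S L A : Type*}

/-! ### Counting over histories -/

open Classical in
theorem count_eq_sum (M : TreeMDP S L A) {k : ℕ} (h : Fin k → Play S L A) (σ : L) :
    (M.count h σ : ℝ) = ∑ i, if M.Consistent (h i).1 σ then 1 else 0 := by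
  rw [count, Finset.card_filter]
  push_cast
  rfl

open Classical in
theorem hits_eq_sum {k : ℕ} (h : Fin k → Play S L A) (σ : L) :
    (hits h σ : ℝ) = ∑ i, if (h i).2 = Sum.inr σ then 1 else 0 := by
  rw [hits, Finset.card_filter]
  push_cast
  rfl

open Classical in
theorem count_snoc (M : TreeMDP S L A) {k : ℕ} (h : Fin k → Play S L A) (y : Play S L A) (σ : L) :
    M.count (Fin.snoc (α := fun _ => Play S L A) h y : Fin (k + 1) → Play S L A) σ =
      M.count h σ + if M.Consistent y.1 σ then 1 else 0 := by
  simp only [count, Finset.card_filter, Fin.sum_univ_castSucc, Fin.snoc_castSucc, Fin.snoc_last]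

theorem count_le (M : TreeMDP S L A) {k : ℕ} (h : Fin k → Play S L A) (σ : L) :
    M.count h σ ≤ k := by
  classical
  exact (Finset.card_filter_le _ _).trans (by simp)

/-! ### Elementary bounds on the exponential -/

theorem exp_le_of_nonpos {x : ℝ} (hx : x ≤ 0) : Real.exp x ≤ 1 + x + 1 / 2 * x ^ 2 := by
  have h := Real.quadratic_le_exp_of_nonneg (neg_nonneg.2 hx)
  have h0 : 0 < 1 + x + 1 / 2 * x ^ 2 := by nlinarith [sq_nonneg (x + 1)]
  -- The product of the two quadratics is `1 + x ^ 4 / 4`, so the lower bound on `exp (-x)` inverts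
  -- to an upper bound on `exp x`.
  have h1 : 1 ≤ (1 + -x + (-x) ^ 2 / 2) * (1 + x + 1 / 2 * x ^ 2) := by
    have : (1 + -x + (-x) ^ 2 / 2) * (1 + x + 1 / 2 * x ^ 2) = 1 + (x ^ 2) ^ 2 / 4 := by ring
    rw [this]
    nlinarith [sq_nonneg (x ^ 2)]
  have h2 : 1 ≤ Real.exp (-x) * (1 + x + 1 / 2 * x ^ 2) :=
    h1.trans (mul_le_mul_of_nonneg_right h h0.le)
  calc Real.exp x = Real.exp x * 1 := (mul_one _).symm
    _ ≤ Real.exp x * (Real.exp (-x) * (1 + x + 1 / 2 * x ^ 2)) :=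
        mul_le_mul_of_nonneg_left h2 (Real.exp_pos _).le
    _ = 1 + x + 1 / 2 * x ^ 2 := by rw [← mul_assoc, ← Real.exp_add]; simp

/-- The third-order remainder is at most `2 / 9 * x ^ 3`, hence at most `x ^ 2 / 6` for `x ≤ 3 / 4`,
and `1 / 2 + 1 / 6 = 2 / 3`. -/
theorem exp_le_of_nonneg {x : ℝ} (hx : 0 ≤ x) (h1 : x ≤ 3 / 4) :
    Real.exp x ≤ 1 + x + 2 / 3 * x ^ 2 := by
  have h := Real.exp_bound' hx (by linarith) (n := 3) (by norm_num)
  norm_num [Finset.sum_range_succ, Nat.factorial] at h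
  nlinarith [mul_nonneg (sq_nonneg x) (sub_nonneg.2 h1)]

/-! ### Weights -/

open Classical in
/-- The weights that turn `hits` into a multiple of the empirical value of `π`, if the counts
are given by `N`. -/
noncomputable def weight (M : TreeMDP S L A) (π : Policy S A) (N : L → ℕ) (θ : ℝ) (σ : L) : ℝ :=
  if M.Consistent π σ then θ * (M.ret σ / N σ) else 0

/-- The smallest entry of `N` among the terminal states consistent with `π`. -/
noncomputable def minOver (M : TreeMDP S L A) (π : Policy S A) (N : L → ℕ) : ℕ :=
  ⨅ σ : ↥(M.X π), N σ

theorem minOver_le (M : TreeMDP S L A) {π : Policy S A} (N : L → ℕ) {σ : L}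
    (h : M.Consistent π σ) : M.minOver π N ≤ N σ :=
  ciInf_le (OrderBot.bddBelow _) (⟨σ, h⟩ : ↥(M.X π))

variable [Fintype S] [Fintype L]

/-! ### An exponential supermartingale -/

-- With `q` the compensator of `π`, the mean of the exponential is at most `1 + q ≤ exp q`.
open Classical in
theorem expect_exp_outcome_le_one (M : TreeMDP S L A) (v : L → ℝ) (κ : ℝ)
    (hv : ∀ σ, Real.exp (v σ) ≤ 1 + v σ + κ * v σ ^ 2) (π : Policy S A) :
    expect (M.outcome π) (fun x => Real.exp (Sum.elim (fun _ => 0) v x -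
      ∑ σ, if M.Consistent π σ then M.leafProb σ * (v σ + κ * v σ ^ 2) else 0)) ≤ 1 := by
  set q := ∑ σ, if M.Consistent π σ then M.leafProb σ * (v σ + κ * v σ ^ 2) else 0 with hq
  have h1 : expect (M.outcome π) (fun x => Real.exp (Sum.elim (fun _ => 0) v x)) ≤ 1 + q := by
    rw [expect_outcome, ← M.sum_leafProb π, hq, ← Finset.sum_add_distrib]
    refine Finset.sum_le_sum fun σ _ => ?_
    split_ifs
    · have := mul_le_mul_of_nonneg_left (hv σ) (M.leafProb_nonneg σ)
      simp only [Sum.elim_inr]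
      linarith
    · simp
  simp only [Real.exp_sub, div_eq_inv_mul, expect_const_mul]
  rw [← div_eq_inv_mul, div_le_one (Real.exp_pos _)]
  exact h1.trans (by linarith [Real.add_one_le_exp q])

/-- The exponent of the supermartingale with weights `v`. -/
noncomputable def exponent (M : TreeMDP S L A) (v : L → ℝ) (κ : ℝ) {k : ℕ}
    (h : Fin k → Play S L A) : ℝ :=
  ∑ σ, ((hits h σ : ℝ) * v σ - M.count h σ * (M.leafProb σ * (v σ + κ * v σ ^ 2)))

/-! ### Deviation of the empirical value -/

theorem exists_minOver_eq (M : TreeMDP S L A) (π : Policy S A) (N : L → ℕ) :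
    ∃ σ, M.Consistent π σ ∧ N σ = M.minOver π N := by
  obtain ⟨τ, hτ⟩ := M.exists_consistent π
  have : Nonempty ↥(M.X π) := ⟨⟨τ, hτ⟩⟩
  obtain ⟨σ, hσ⟩ := Nat.sInf_mem (Set.range_nonempty fun σ : ↥(M.X π) => N σ)
  exact ⟨σ, σ.2, hσ⟩

/-- The linear part of the exponent is `θ` times the estimation error. In the quadratic part `ret σ
^ 2 / count σ` is at most one over the smallest count, and the leaf probabilities sum to one. -/
theorem exponent_weight_ge (M : TreeMDP S L A) (hret : ∀ σ, M.ret σ ∈ Set.Icc (0 : ℝ) 1)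
    (π : Policy S A) {k : ℕ} (h : Fin k → Play S L A) (hc : ∀ σ, M.count h σ ≠ 0) (θ κ : ℝ)
    (hκ : 0 ≤ κ) :
    θ * (M.empValue h π - M.value π) - κ * θ ^ 2 / M.polCount h π ≤
      M.exponent (M.weight π (M.count h) θ) κ h := by
  classical
  obtain ⟨τ, hτ, hm⟩ := M.exists_minOver_eq π (M.count h)
  have hm0 : (0 : ℝ) < M.polCount h π := by
    rw [show M.polCount h π = M.count h τ from hm.symm]
    exact_mod_cast Nat.pos_of_ne_zero (hc τ)
  have hE : M.empValue h π =
      ∑ σ, if M.Consistent π σ then (hits h σ : ℝ) / M.count h σ * M.ret σ else 0 := by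
    rw [empValue, Finset.sum_filter]
    rfl
  rw [hE, value_eq_sum, ← Finset.sum_sub_distrib, Finset.mul_sum,
    show κ * θ ^ 2 / M.polCount h π = κ * θ ^ 2 / M.polCount h π * 1 from (mul_one _).symm,
    ← M.sum_leafProb π, Finset.mul_sum, ← Finset.sum_sub_distrib, exponent]
  refine Finset.sum_le_sum fun σ _ => ?_
  unfold weight
  split_ifs with hσ
  · have hn : (0 : ℝ) < M.count h σ := by exact_mod_cast Nat.pos_of_ne_zero (hc σ)
    have hle : (M.polCount h π : ℝ) ≤ M.count h σ := by
      exact_mod_cast M.minOver_le (M.count h) hσ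
    have h1 : M.ret σ ^ 2 / M.count h σ ≤ 1 / M.polCount h π :=
      div_le_div₀ zero_le_one (pow_le_one₀ (hret σ).1 (hret σ).2) hm0 hle
    have h2 : κ * θ ^ 2 * M.leafProb σ * (M.ret σ ^ 2 / M.count h σ) ≤
        κ * θ ^ 2 * M.leafProb σ * (1 / M.polCount h π) :=
      mul_le_mul_of_nonneg_left h1
        (mul_nonneg (mul_nonneg hκ (sq_nonneg _)) (M.leafProb_nonneg σ))
    have h3 : (hits h σ : ℝ) * (θ * (M.ret σ / M.count h σ)) - M.count h σ *
        (M.leafProb σ * (θ * (M.ret σ / M.count h σ) + κ * (θ * (M.ret σ / M.count h σ)) ^ 2)) =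
        θ * ((hits h σ : ℝ) / M.count h σ * M.ret σ - M.leafProb σ * M.ret σ) -
          κ * θ ^ 2 * M.leafProb σ * (M.ret σ ^ 2 / M.count h σ) := by
      field_simp
      ring
    rw [h3]
    have h4 : κ * θ ^ 2 / M.polCount h π * M.leafProb σ =
        κ * θ ^ 2 * M.leafProb σ * (1 / M.polCount h π) := by ring
    rw [h4]
    linarith
  · simp

theorem mul_width_sq {m : ℕ} (hm : 0 < m) {δ : ℝ} (h0 : 0 < δ) (h1 : δ ≤ 1) :
    3 / 8 * m * width m δ ^ 2 = -Real.log δ := by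
  have hm' : (0 : ℝ) < m := by exact_mod_cast hm
  have hl : Real.log δ ≤ 0 := Real.log_nonpos h0.le h1
  rw [width, one_div, Real.log_inv, Real.sq_sqrt]
  · field_simp
  · exact mul_nonneg (by positivity) (by linarith)

theorem width_nonneg (m : ℕ) (δ : ℝ) : 0 ≤ width m δ := Real.sqrt_nonneg _

/-- The scale of the exponential moment used against overestimation. -/
noncomputable def upScale (m : ℕ) (δ : ℝ) : ℝ := 3 / 4 * (m * min (width m δ) 1)

/-- The scale of the exponential moment used against underestimation. -/
noncomputable def downScale (m : ℕ) (δ : ℝ) : ℝ := -(m * width m δ)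

/-- The value of `π` is misestimated: it exceeds its upper confidence bound, or the empirical
value is too large by a width that is at most one. -/
def Misestimated (M : TreeMDP S L A) {k : ℕ} (h : Fin k → Play S L A) (δ : ℝ)
    (π : Policy S A) : Prop :=
  M.ucb h π δ < M.value π ∨
    (width (M.polCount h π) δ ≤ 1 ∧ M.value π + width (M.polCount h π) δ < M.empValue h π)

/-- The sum of the two exponential moments that control the event `Misestimated`. -/
noncomputable def tailSum (M : TreeMDP S L A) {k : ℕ} (h : Fin k → Play S L A) (δ : ℝ)
    (π : Policy S A) (N : L → ℕ) : ℝ :=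
  Real.exp (M.exponent (M.weight π N (upScale (M.minOver π N) δ)) (2 / 3) h) +
    Real.exp (M.exponent (M.weight π N (downScale (M.minOver π N) δ)) (1 / 2) h)

theorem one_le_mul_tailSum (M : TreeMDP S L A) (hret : ∀ σ, M.ret σ ∈ Set.Icc (0 : ℝ) 1)
    (π : Policy S A) {k : ℕ} (h : Fin k → Play S L A) (hc : ∀ σ, M.count h σ ≠ 0) {δ : ℝ}
    (h0 : 0 < δ) (h1 : δ ≤ 1) (hmis : M.Misestimated h δ π) :
    1 ≤ δ * M.tailSum h δ π (M.count h) := by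
  obtain ⟨τ, hτ, hm⟩ := M.exists_minOver_eq π (M.count h)
  have hm0 : 0 < M.polCount h π := by
    rw [show M.polCount h π = M.count h τ from hm.symm]
    exact Nat.pos_of_ne_zero (hc τ)
  have hmr : (0 : ℝ) < M.polCount h π := by exact_mod_cast hm0
  have hw := mul_width_sq hm0 h0 h1
  have hw0 := width_nonneg (M.polCount h π) δ
  have key : ∀ x y : ℝ, 0 ≤ y → -Real.log δ ≤ x →
      1 ≤ δ * (Real.exp x + y) ∧ 1 ≤ δ * (y + Real.exp x) := by
    intro x y hy hx
    have : 1 ≤ δ * Real.exp x := by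
      calc 1 = Real.exp (Real.log δ + -Real.log δ) := by simp
        _ ≤ Real.exp (Real.log δ + x) := Real.exp_le_exp.2 (by linarith)
        _ = δ * Real.exp x := by rw [Real.exp_add, Real.exp_log h0]
    have := mul_nonneg h0.le hy
    constructor <;> linarith
  -- At the true counts `minOver` is by definition `polCount`.
  change 1 ≤ δ * (Real.exp (M.exponent (M.weight π (M.count h) (upScale (M.polCount h π) δ)) _ h) +
    Real.exp (M.exponent (M.weight π (M.count h) (downScale (M.polCount h π) δ)) _ h))
  set m := M.polCount h π with hmdef
  set β := width m δ with hβ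
  rcases hmis with hlow | ⟨hβ1, hup⟩
  -- With `θ = -mβ` and `κ = 1 / 2` the exponent is at least `mβ² / 2`, more than the required `3mβ²
  -- / 8`.
  · refine (key _ _ (Real.exp_pos _).le ?_).2
    refine le_trans ?_ (M.exponent_weight_ge hret π h hc _ _ (by norm_num))
    rw [← hmdef, downScale, ← hβ, ← hw]
    have e : -((m : ℝ) * β) * (M.empValue h π - M.value π) - 1 / 2 * (-((m : ℝ) * β)) ^ 2 / m =
        m * β * (M.value π - M.empValue h π) - 1 / 2 * m * β ^ 2 := by
      field_simp
      ring
    rw [e]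
    have h2 : β ≤ M.value π - M.empValue h π := by
      have : M.ucb h π δ = M.empValue h π + β := rfl
      linarith
    have := mul_le_mul_of_nonneg_left h2 (mul_nonneg hmr.le hw0)
    nlinarith [mul_nonneg hmr.le (sq_nonneg β)]
  -- The choice `θ = 3mβ / 4` maximises `θβ - 2θ² / (3m)`, with value `3mβ² / 8`; this is the source
  -- of the `8 / 3` in the width.
  · refine (key _ _ (Real.exp_pos _).le ?_).1
    refine le_trans ?_ (M.exponent_weight_ge hret π h hc _ _ (by norm_num))
    rw [← hmdef, upScale, ← hβ, ← hw, min_eq_left hβ1]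
    have e : 3 / 4 * ((m : ℝ) * β) * (M.empValue h π - M.value π) -
        2 / 3 * (3 / 4 * ((m : ℝ) * β)) ^ 2 / m =
        3 / 4 * (m * β * (M.empValue h π - M.value π)) - 3 / 8 * m * β ^ 2 := by
      field_simp
      ring
    rw [e]
    have h2 : β ≤ M.empValue h π - M.value π := by linarith
    have := mul_le_mul_of_nonneg_left h2 (mul_nonneg hmr.le hw0)
    nlinarith

variable [DecidableEq S] [Fintype A]

/-- Hits and counts are sums over episodes, so the exponential factors into one compensated term per
episode. -/
theorem expect_exp_exponent_le_one (M : TreeMDP S L A) (alg : Learner S L A) (v : L → ℝ) (κ : ℝ)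
    (hv : ∀ σ, Real.exp (v σ) ≤ 1 + v σ + κ * v σ ^ 2) (k : ℕ) :
    expect (M.history alg k) (fun h => Real.exp (M.exponent v κ h)) ≤ 1 := by
  classical
  have h1 := M.expect_prod_history_le_one alg
    (fun y => Real.exp (Sum.elim (fun _ => 0) v y.2 -
      ∑ σ, if M.Consistent y.1 σ then M.leafProb σ * (v σ + κ * v σ ^ 2) else 0))
    (fun y => (Real.exp_pos _).le) (M.expect_exp_outcome_le_one v κ hv) k
  convert h1 using 3 with h
  rw [← Real.exp_sum]
  congr 1
  rw [exponent]
  have h2 : ∀ x : S ⊕ L, Sum.elim (fun _ => 0) v x = ∑ σ, if x = Sum.inr σ then v σ else 0 := by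
    rintro (s | τ) <;> simp
  simp only [h2, ← Finset.sum_sub_distrib]
  rw [Finset.sum_comm]
  refine Finset.sum_congr rfl fun σ _ => ?_
  rw [hits_eq_sum, count_eq_sum, Finset.sum_mul, Finset.sum_mul, ← Finset.sum_sub_distrib]
  simp only [ite_mul, one_mul, zero_mul]

theorem expect_tailSum_le (M : TreeMDP S L A) (hret : ∀ σ, M.ret σ ∈ Set.Icc (0 : ℝ) 1)
    (alg : Learner S L A) (k : ℕ) (δ : ℝ) (π : Policy S A) (N : L → ℕ) (hN : ∀ σ, N σ ≠ 0) :
    expect (M.history alg k) (fun h => M.tailSum h δ π N) ≤ 2 := by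
  classical
  simp only [tailSum]
  rw [expect_add]
  have hw0 := width_nonneg (M.minOver π N) δ
  have hq : ∀ σ, M.Consistent π σ →
      0 ≤ M.ret σ / N σ ∧ M.minOver π N * (M.ret σ / N σ) ≤ 1 := by
    intro σ hσ
    have hn : (0 : ℝ) < N σ := by exact_mod_cast Nat.pos_of_ne_zero (hN σ)
    have hle : (M.minOver π N : ℝ) ≤ N σ := by exact_mod_cast M.minOver_le N hσ
    refine ⟨div_nonneg (hret σ).1 hn.le, ?_⟩
    rw [← mul_div_assoc, div_le_one hn]
    exact (mul_le_of_le_one_right (Nat.cast_nonneg _) (hret σ).2).trans hle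
  have hup := M.expect_exp_exponent_le_one alg
    (M.weight π N (upScale (M.minOver π N) δ)) (2 / 3) (fun σ => ?_) k
  have hdown := M.expect_exp_exponent_le_one alg
    (M.weight π N (downScale (M.minOver π N) δ)) (1 / 2) (fun σ => ?_) k
  · linarith
  · refine exp_le_of_nonpos ?_
    unfold weight downScale
    split_ifs with hσ
    · have := mul_nonneg (mul_nonneg (Nat.cast_nonneg (α := ℝ) (M.minOver π N)) hw0) (hq σ hσ).1
      linarith
    · exact le_rfl
  -- Capping the width at one keeps every weight at most `3 / 4`, where `exp_le_of_nonneg` applies.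
  · have hmin0 : 0 ≤ min (width (M.minOver π N) δ) 1 := le_min hw0 zero_le_one
    have hmin1 : min (width (M.minOver π N) δ) 1 ≤ 1 := min_le_right _ _
    unfold weight upScale
    split_ifs with hσ
    · obtain ⟨h1, h2⟩ := hq σ hσ
      refine exp_le_of_nonneg (by positivity) ?_
      calc 3 / 4 * (M.minOver π N * min (width (M.minOver π N) δ) 1) * (M.ret σ / N σ)
          = 3 / 4 * (min (width (M.minOver π N) δ) 1 * (M.minOver π N * (M.ret σ / N σ))) := by
            ring
        _ ≤ 3 / 4 * (1 * 1) := by gcongr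
        _ = 3 / 4 := by norm_num
    · simp

open Classical in
/-- The probability that all terminal states have been played and some policy is misestimated. -/
theorem expect_misestimated_le (M : TreeMDP S L A) (hret : ∀ σ, M.ret σ ∈ Set.Icc (0 : ℝ) 1)
    (alg : Learner S L A) (k : ℕ) {δ : ℝ} (h0 : 0 < δ) (h1 : δ ≤ 1) :
    expect (M.history alg k) (fun h =>
      if (∀ σ, M.count h σ ≠ 0) ∧ ∃ π, M.Misestimated h δ π then 1 else 0) ≤
      δ * (Fintype.card (Policy S A) * k ^ Fintype.card L * 2) := by
  -- All values the count vector can take once every terminal state has been played. Each is treated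
  -- as deterministic in the union bound.
  let B : Finset (L → ℕ) := Fintype.piFinset fun _ => Finset.Icc 1 k
  calc _ ≤ expect (M.history alg k) (fun h =>
        δ * ∑ π : Policy S A, ∑ N ∈ B, M.tailSum h δ π N) := by
        refine expect_mono _ fun h => ?_
        have hpos : ∀ π N, 0 ≤ M.tailSum h δ π N := fun π N =>
          add_nonneg (Real.exp_pos _).le (Real.exp_pos _).le
        split_ifs with hh
        · obtain ⟨hc, π, hπ⟩ := hh
          refine (M.one_le_mul_tailSum hret π h hc h0 h1 hπ).trans
            (mul_le_mul_of_nonneg_left ?_ h0.le)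
          have hB : M.count h ∈ B := by
            refine Fintype.mem_piFinset.2 fun σ => Finset.mem_Icc.2 ?_
            exact ⟨Nat.one_le_iff_ne_zero.2 (hc σ), M.count_le h σ⟩
          calc M.tailSum h δ π (M.count h) ≤ ∑ N ∈ B, M.tailSum h δ π N :=
                Finset.single_le_sum (fun N _ => hpos π N) hB
            _ ≤ _ := Finset.single_le_sum
                (f := fun π => ∑ N ∈ B, M.tailSum h δ π N)
                (fun π _ => Finset.sum_nonneg fun N _ => hpos π N) (Finset.mem_univ π)
        · exact mul_nonneg h0.le
            (Finset.sum_nonneg fun π _ => Finset.sum_nonneg fun N _ => hpos π N)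
    _ = δ * ∑ π : Policy S A, ∑ N ∈ B, expect (M.history alg k) (fun h => M.tailSum h δ π N) := by
        simp only [expect_const_mul, expect_sum]
    _ ≤ δ * ∑ π : Policy S A, ∑ N ∈ B, 2 := by
        refine mul_le_mul_of_nonneg_left ?_ h0.le
        refine Finset.sum_le_sum fun π _ => Finset.sum_le_sum fun N hN => ?_
        refine M.expect_tailSum_le hret alg k δ π N fun σ => ?_
        have := (Finset.mem_Icc.1 (Fintype.mem_piFinset.1 hN σ)).1
        omega
    _ = _ := by
        simp only [Finset.sum_const, nsmul_eq_mul, Finset.card_univ, B, Fintype.card_piFinset,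
          Finset.prod_const, Nat.card_Icc, Nat.add_sub_cancel]
        push_cast
        ring

end Concentration

/-! ### From confidence bounds to regret. -/

section Regret

variable {S L A : Type*} [Fintype S] [Fintype L]

/-- The terminal states that are consistent with a suboptimal policy. -/
noncomputable def badLeaves (M : TreeMDP S L A) : Finset L :=
  open Classical in Finset.univ.filter fun σ => ¬ M.Y σ ⊆ M.Opt

theorem mem_badLeaves (M : TreeMDP S L A) {σ : L} : σ ∈ M.badLeaves ↔ ¬ M.Y σ ⊆ M.Opt := by
  simp [badLeaves]

variable [Fintype A]

/-! ### Gaps -/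

theorem value_le_optValue (M : TreeMDP S L A) (π : Policy S A) : M.value π ≤ M.optValue :=
  le_ciSup (Set.finite_range M.value).bddAbove π

theorem gap_nonneg (M : TreeMDP S L A) (π : Policy S A) : 0 ≤ M.gap π :=
  sub_nonneg.2 (M.value_le_optValue π)

theorem exists_value_eq_optValue (M : TreeMDP S L A) (π : Policy S A) :
    ∃ π', M.value π' = M.optValue := by
  have : Nonempty (Policy S A) := ⟨π⟩
  exact exists_eq_ciSup_of_finite

theorem mem_Opt_iff (M : TreeMDP S L A) (π : Policy S A) : π ∈ M.Opt ↔ M.gap π = 0 := by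
  have : Nonempty (Policy S A) := ⟨π⟩
  constructor
  · intro h
    exact sub_eq_zero.2 (le_antisymm (ciSup_le h) (M.value_le_optValue π))
  · intro h π'
    rw [← sub_eq_zero.1 h]
    exact M.value_le_optValue π'

theorem gap_pos (M : TreeMDP S L A) {π : Policy S A} (h : π ∉ M.Opt) : 0 < M.gap π :=
  lt_of_le_of_ne (M.gap_nonneg π) fun h0 => h ((M.mem_Opt_iff π).2 h0.symm)

theorem gap_le_one (M : TreeMDP S L A) (hret : ∀ σ, M.ret σ ∈ Set.Icc (0 : ℝ) 1)
    (π : Policy S A) : M.gap π ≤ 1 := by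
  obtain ⟨π', h⟩ := M.exists_value_eq_optValue π
  have h1 := (M.value_mem_Icc hret π).1
  have h2 := (M.value_mem_Icc hret π').2
  rw [gap, ← h]
  linarith

theorem gapMin_le (M : TreeMDP S L A) {π : Policy S A} {σ : L} (h : M.Consistent π σ)
    (ho : π ∉ M.Opt) : M.gapMin σ ≤ M.gap π :=
  ciInf_le (Set.finite_range fun π : ↥(M.Y σ \ M.Opt) => M.gap π).bddBelow ⟨π, h, ho⟩

theorem le_gapMax (M : TreeMDP S L A) {π : Policy S A} {σ : L} (h : M.Consistent π σ)
    (ho : π ∉ M.Opt) : M.gap π ≤ M.gapMax σ :=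
  le_ciSup (Set.finite_range fun π : ↥(M.Y σ \ M.Opt) => M.gap π).bddAbove ⟨π, h, ho⟩

theorem gapMin_pos (M : TreeMDP S L A) {σ : L} (h : ¬ M.Y σ ⊆ M.Opt) : 0 < M.gapMin σ := by
  obtain ⟨π, h1, h2⟩ := Set.not_subset.1 h
  have : Nonempty ↥(M.Y σ \ M.Opt) := ⟨⟨π, h1, h2⟩⟩
  obtain ⟨π', h'⟩ := exists_eq_ciInf_of_finite (f := fun π : ↥(M.Y σ \ M.Opt) => M.gap π)
  rw [gapMin, ← h']
  exact M.gap_pos π'.2.2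

theorem gapMax_nonneg (M : TreeMDP S L A) (σ : L) : 0 ≤ M.gapMax σ :=
  Real.iSup_nonneg fun π => M.gap_nonneg π

theorem gapMin_le_one (M : TreeMDP S L A) (hret : ∀ σ, M.ret σ ∈ Set.Icc (0 : ℝ) 1) {σ : L}
    (h : ¬ M.Y σ ⊆ M.Opt) : M.gapMin σ ≤ 1 := by
  obtain ⟨π, h1, h2⟩ := Set.not_subset.1 h
  exact (M.gapMin_le h1 h2).trans (M.gap_le_one hret π)

theorem gapMin_le_gapMax (M : TreeMDP S L A) {σ : L} (h : ¬ M.Y σ ⊆ M.Opt) :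
    M.gapMin σ ≤ M.gapMax σ := by
  obtain ⟨π, h1, h2⟩ := Set.not_subset.1 h
  exact (M.gapMin_le h1 h2).trans (M.le_gapMax h1 h2)

/-! ### Charging plays to terminal states -/

/-- An accumulated charge: each terminal state pays its largest gap for the first `K σ` plays. -/
noncomputable def charge (M : TreeMDP S L A) (K : L → ℕ) {k : ℕ} (h : Fin k → Play S L A) : ℝ :=
  ∑ σ ∈ M.badLeaves, M.gapMax σ * (min (M.count h σ) (K σ) : ℕ)

theorem charge_le (M : TreeMDP S L A) (K : L → ℕ) {k : ℕ} (h : Fin k → Play S L A) :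
    M.charge K h ≤ ∑ σ ∈ M.badLeaves, M.gapMax σ * K σ := by
  refine Finset.sum_le_sum fun σ _ => mul_le_mul_of_nonneg_left ?_ (M.gapMax_nonneg σ)
  exact_mod_cast min_le_right _ _

theorem charge_nonneg (M : TreeMDP S L A) (K : L → ℕ) {k : ℕ} (h : Fin k → Play S L A) :
    0 ≤ M.charge K h :=
  Finset.sum_nonneg fun σ _ => mul_nonneg (M.gapMax_nonneg σ) (Nat.cast_nonneg _)

theorem charge_le_charge_snoc (M : TreeMDP S L A) (K : L → ℕ) {k : ℕ} (h : Fin k → Play S L A)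
    (y : Play S L A) :
    M.charge K h ≤ M.charge K (Fin.snoc (α := fun _ => Play S L A) h y) := by
  refine Finset.sum_le_sum fun σ _ => mul_le_mul_of_nonneg_left ?_ (M.gapMax_nonneg σ)
  rw [count_snoc]
  exact_mod_cast min_le_min_right _ (Nat.le_add_right _ _)

/-- The play raises the count of `σ` while it is still below its cap, so `σ` alone pays `gapMax σ`,
which covers the gap; no other term decreases. -/
theorem charge_add_gap_le (M : TreeMDP S L A) (K : L → ℕ) {k : ℕ} (h : Fin k → Play S L A)
    (y : Play S L A) {σ : L} (hσ : M.Consistent y.1 σ) (ho : y.1 ∉ M.Opt)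
    (hK : M.count h σ < K σ) :
    M.charge K h + M.gap y.1 ≤ M.charge K (Fin.snoc (α := fun _ => Play S L A) h y) := by
  classical
  have hb : σ ∈ M.badLeaves := M.mem_badLeaves.2 fun hs => ho (hs hσ)
  rw [charge, charge, ← Finset.add_sum_erase _ _ hb, ← Finset.add_sum_erase _ _ hb]
  have h1 : ∑ τ ∈ M.badLeaves.erase σ, M.gapMax τ * (min (M.count h τ) (K τ) : ℕ) ≤
      ∑ τ ∈ M.badLeaves.erase σ, M.gapMax τ *
        (min (M.count (Fin.snoc (α := fun _ => Play S L A) h y : Fin (k + 1) → Play S L A) τ)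
          (K τ) : ℕ) := by
    refine Finset.sum_le_sum fun τ _ => mul_le_mul_of_nonneg_left ?_ (M.gapMax_nonneg τ)
    rw [count_snoc]
    exact_mod_cast min_le_min_right _ (Nat.le_add_right _ _)
  have h2 : min (M.count (Fin.snoc (α := fun _ => Play S L A) h y : Fin (k + 1) → Play S L A) σ)
      (K σ) = min (M.count h σ) (K σ) + 1 := by
    rw [count_snoc, if_pos hσ]
    omega
  rw [h2]
  push_cast
  have h3 := M.le_gapMax hσ ho
  push_cast at h1
  linarith

/-! ### Regret -/

variable [DecidableEq S]

theorem regret_eq (M : TreeMDP S L A) (alg : Learner S L A) (T : ℕ) :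
    M.regret alg T =
      ∑ k ∈ Finset.range T, expect (M.history alg k) fun h => expect (alg k h) M.gap := by
  refine Finset.sum_congr rfl fun k _ => ?_
  rw [← expect_bind]
  change M.optValue - expect (M.policyLaw alg k) M.value =
    expect (M.policyLaw alg k) fun π => M.optValue - M.value π
  rw [expect_sub, expect_const]

/-! ### The mistake probability -/

theorem neg_log_mistake [Nonempty A] {t : ℕ} (ht : 0 < t) :
    -Real.log (mistake S L A t) =
      Real.log (Fintype.card (Policy S A)) + (Fintype.card L + 4) * Real.log t := by
  have h1 : (Fintype.card (Policy S A) : ℝ) ≠ 0 := by exact_mod_cast Fintype.card_ne_zero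
  have h2 : (t : ℝ) ≠ 0 := by exact_mod_cast ht.ne'
  rw [mistake, one_div, Real.log_inv, neg_neg, Real.log_mul h1 (pow_ne_zero _ h2), Real.log_pow]
  push_cast
  ring

theorem mistake_pos [Nonempty A] {t : ℕ} (ht : 0 < t) : 0 < mistake S L A t := by
  have h1 : (0 : ℝ) < Fintype.card (Policy S A) := by exact_mod_cast Fintype.card_pos
  have h2 : (0 : ℝ) < t := by exact_mod_cast ht
  unfold mistake
  positivity

theorem mistake_le_one [Nonempty A] {t : ℕ} (ht : 0 < t) : mistake S L A t ≤ 1 := by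
  have h1 : (1 : ℝ) ≤ Fintype.card (Policy S A) := by
    exact_mod_cast Nat.one_le_iff_ne_zero.2 Fintype.card_ne_zero
  have h2 : (1 : ℝ) ≤ t := by exact_mod_cast ht
  exact div_le_one_of_le₀ (one_le_mul_of_one_le_of_one_le h1 (one_le_pow₀ h2)) (by positivity)

/-- The power `|Σ|` of `t = k + 1` absorbs the number of count vectors; the remaining fourth power
makes the failure probabilities summable. -/
theorem mistake_mul_le [Nonempty A] (k : ℕ) :
    mistake S L A (k + 1) * (Fintype.card (Policy S A) * k ^ Fintype.card L * 2) ≤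
      2 / ((k : ℝ) + 1) ^ 4 := by
  have h1 : (0 : ℝ) < Fintype.card (Policy S A) := by exact_mod_cast Fintype.card_pos
  have h2 : (k : ℝ) ^ Fintype.card L ≤ ((k : ℝ) + 1) ^ Fintype.card L :=
    pow_le_pow_left₀ (Nat.cast_nonneg k) (by linarith) _
  have h3 : (0 : ℝ) < (k : ℝ) + 1 := by positivity
  rw [mistake, one_div, pow_add, inv_mul_eq_div, div_le_div_iff₀ (by positivity) (by positivity)]
  push_cast
  have : 0 ≤ (Fintype.card (Policy S A) : ℝ) * 2 * ((k : ℝ) + 1) ^ 4 := by positivity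
  nlinarith [mul_le_mul_of_nonneg_left h2 this]

/-! ### Plays of suboptimal policies -/

/-- If no policy is misestimated, a suboptimal policy is played only if it is consistent with a
terminal state of small count. -/
theorem exists_count_le (M : TreeMDP S L A) (hret : ∀ σ, M.ret σ ∈ Set.Icc (0 : ℝ) 1)
    {k : ℕ} (h : Fin k → Play S L A) {π : Policy S A} (hπ : M.UcbTChoice h π)
    (hgood : ¬ ((∀ σ, M.count h σ ≠ 0) ∧ ∃ π, M.Misestimated h (mistake S L A (k + 1)) π))
    (ho : π ∉ M.Opt) :
    ∃ σ, M.Consistent π σ ∧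
      (M.count h σ : ℝ) ≤ 32 / 3 * -Real.log (mistake S L A (k + 1)) / M.gap π ^ 2 := by
  have : Nonempty A := ⟨π M.root⟩
  have hδ0 : 0 < mistake S L A (k + 1) := mistake_pos k.succ_pos
  have hδ1 : mistake S L A (k + 1) ≤ 1 := mistake_le_one k.succ_pos
  have hℓ := Real.log_nonpos hδ0.le hδ1
  have hg := M.gap_pos ho
  rcases hπ with ⟨σ, hσ, hc⟩ | ⟨hc, hmax⟩
  · refine ⟨σ, hc, ?_⟩
    rw [hσ, Nat.cast_zero]
    exact div_nonneg (by linarith) (sq_nonneg _)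
  · obtain ⟨σ, hσ, hm⟩ := M.exists_minOver_eq π (M.count h)
    refine ⟨σ, hσ, ?_⟩
    by_contra! hlt
    have hm0 : 0 < M.polCount h π := by
      rw [show M.polCount h π = M.count h σ from hm.symm]
      exact Nat.pos_of_ne_zero (hc σ)
    rw [hm, show M.minOver π (M.count h) = M.polCount h π from rfl, div_lt_iff₀ (by positivity),
      ← mul_width_sq hm0 hδ0 hδ1] at hlt
    have hmr : (0 : ℝ) < M.polCount h π := by exact_mod_cast hm0
    -- Since `32 / 3 = 4 * (8 / 3)`, a count above the threshold means that twice the width is below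
    -- the gap.
    have hw : 2 * width (M.polCount h π) (mistake S L A (k + 1)) < M.gap π := by
      refine lt_of_pow_lt_pow_left₀ 2 hg.le (lt_of_mul_lt_mul_left ?_ hmr.le)
      linarith
    obtain ⟨π', hπ'⟩ := M.exists_value_eq_optValue π
    have hno : ∀ π, ¬ M.Misestimated h (mistake S L A (k + 1)) π := fun π hmis =>
      hgood ⟨hc, π, hmis⟩
    have h1 := not_lt.1 (not_or.1 (hno π')).1
    have h2 := (not_or.1 (hno π)).2
    have h3 := M.gap_le_one hret π
    have h4 := width_nonneg (M.polCount h π) (mistake S L A (k + 1))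
    -- The gap is at most one, so the width is below one half and the overestimation event is
    -- available.
    have h5 := not_lt.1 fun h5 => h2 ⟨by linarith, h5⟩
    have h6 := hmax π'
    rw [ucb, ucb] at h6
    rw [ucb] at h1
    rw [gap] at hw
    -- The contradiction is `V* ≤ ucb π' ≤ ucb π ≤ V(π) + 2 * width < V*`.
    linarith

/-- Each term is at most the telescoping difference `4 / (k + 1) - 4 / (k + 2)`. -/
theorem sum_inv_pow_four_le (T : ℕ) :
    ∑ k ∈ Finset.range T, (2 : ℝ) / ((k : ℝ) + 1) ^ 4 ≤ 6 - 4 / ((T : ℝ) + 1) := by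
  induction T with
  | zero => norm_num
  | succ T ih =>
    rw [Finset.sum_range_succ]
    have hT : (0 : ℝ) ≤ T := Nat.cast_nonneg T
    have h1 : (4 : ℝ) / (T + 1) - 4 / (T + 1 + 1) = 4 / ((T + 1) * (T + 2)) := by
      field_simp
      ring
    have h2 : (2 : ℝ) / (T + 1) ^ 4 ≤ 4 / ((T + 1) * (T + 2)) := by
      rw [div_le_div_iff₀ (by positivity) (by positivity)]
      nlinarith [mul_nonneg hT hT, mul_nonneg hT (mul_nonneg hT hT),
        mul_nonneg hT (mul_nonneg hT (mul_nonneg hT hT))]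
    push_cast
    linarith

/-- The regret is at most the total charge plus a constant. -/
theorem regret_le_charge (M : TreeMDP S L A) [Nonempty A]
    (hret : ∀ σ, M.ret σ ∈ Set.Icc (0 : ℝ) 1) (alg : Learner S L A) (halg : M.IsUcbT alg) (T : ℕ)
    (K : L → ℕ) (hK : ∀ σ, 32 / 3 * (Real.log (Fintype.card (Policy S A)) +
      (Fintype.card L + 4) * Real.log T) / M.gapMin σ ^ 2 < K σ) :
    M.regret alg T ≤ (∑ σ ∈ M.badLeaves, M.gapMax σ * K σ) + 6 := by
  classical
  have hstep : ∀ k ∈ Finset.range T,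
      expect (M.history alg k) (fun h => expect (alg k h) M.gap) ≤
        (expect (M.history alg (k + 1)) (M.charge K) - expect (M.history alg k) (M.charge K)) +
          2 / ((k : ℝ) + 1) ^ 4 := by
    intro k hk
    have hkT : k + 1 ≤ T := Finset.mem_range.1 hk
    have hδ0 : 0 < mistake S L A (k + 1) := mistake_pos k.succ_pos
    have hbad := (M.expect_misestimated_le hret alg k hδ0 (mistake_le_one k.succ_pos)).trans
      (mistake_mul_le k)
    have hmono : expect (M.history alg k) (fun h => expect (alg k h) M.gap) ≤
        expect (M.history alg k) (fun h =>
          (expect (alg k h) (fun π => expect (M.outcome π) fun x =>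
            M.charge K (Fin.snoc (α := fun _ => Play S L A) h (π, x))) - M.charge K h) +
          if (∀ σ, M.count h σ ≠ 0) ∧ ∃ π, M.Misestimated h (mistake S L A (k + 1)) π
            then 1 else 0) := by
      refine expect_mono _ fun h => ?_
      set b : ℝ := if (∀ σ, M.count h σ ≠ 0) ∧
        ∃ π, M.Misestimated h (mistake S L A (k + 1)) π then 1 else 0 with hb
      -- Constants become expectations under the same law, so the comparison can be made for each
      -- policy and outcome: the gap is paid by the increase of the charge or by `b`.
      rw [sub_add_eq_add_sub, ← expect_const (alg k h) b, ← expect_add,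
        ← expect_const (alg k h) (M.charge K h), ← expect_sub]
      refine expect_mono_of_support _ fun π hπ => ?_
      rw [← expect_const (M.outcome π) (M.gap π), ← expect_const (M.outcome π) b, ← expect_add,
        ← expect_const (M.outcome π) (M.charge K h), ← expect_sub]
      refine expect_mono _ fun x => ?_
      have hb0 : 0 ≤ b := by
        rw [hb]
        split_ifs <;> norm_num
      have hmon := M.charge_le_charge_snoc K h (π, x)
      by_cases ho : π ∈ M.Opt
      · rw [(M.mem_Opt_iff π).1 ho]
        linarith
      by_cases hm : (∀ σ, M.count h σ ≠ 0) ∧ ∃ π, M.Misestimated h (mistake S L A (k + 1)) π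
      · rw [hb, if_pos hm]
        linarith [M.gap_le_one hret π]
      · obtain ⟨σ, hσ, hcount⟩ := M.exists_count_le hret h (halg k h π hπ) hm ho
        have hlt : M.count h σ < K σ := by
          have hgm := M.gapMin_pos (σ := σ) fun hs => ho (hs hσ)
          have hlog : Real.log ((k + 1 : ℕ) : ℝ) ≤ Real.log T :=
            Real.log_le_log (by positivity) (by exact_mod_cast hkT)
          have hnn : 0 ≤ -Real.log (mistake S L A (k + 1)) :=
            neg_nonneg.2 (Real.log_nonpos hδ0.le (mistake_le_one k.succ_pos))
          have hle : -Real.log (mistake S L A (k + 1)) ≤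
              Real.log (Fintype.card (Policy S A)) + (Fintype.card L + 4) * Real.log T := by
            rw [neg_log_mistake k.succ_pos]
            gcongr
          have : (M.count h σ : ℝ) < K σ := by
            refine lt_of_le_of_lt (hcount.trans ?_) (hK σ)
            have := M.gapMin_le hσ ho
            gcongr
          exact_mod_cast this
        have := M.charge_add_gap_le K h (π, x) hσ ho hlt
        dsimp only at this
        linarith
    -- The expected charge after one more episode is the next term of a telescoping sum.
    rw [expect_add, expect_sub, ← expect_history_succ] at hmono
    linarith
  rw [regret_eq]
  refine (Finset.sum_le_sum hstep).trans ?_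
  rw [Finset.sum_add_distrib, Finset.sum_range_sub fun k => expect (M.history alg k) (M.charge K)]
  have h1 : expect (M.history alg T) (M.charge K) ≤ ∑ σ ∈ M.badLeaves, M.gapMax σ * K σ :=
    (expect_mono _ (M.charge_le K)).trans_eq (expect_const _ _)
  have h2 : 0 ≤ expect (M.history alg 0) (M.charge K) :=
    (expect_const (M.history alg 0) 0).symm.trans_le (expect_mono _ (M.charge_nonneg K))
  have h3 := sum_inv_pow_four_le T
  have h4 : (0 : ℝ) ≤ 4 / (T + 1) := by positivity
  linarith

theorem regret_eq_zero_of_badLeaves_eq_empty (M : TreeMDP S L A) (alg : Learner S L A) (T : ℕ)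
    (h : M.badLeaves = ∅) : M.regret alg T = 0 := by
  have h0 : M.gap = fun _ => 0 := by
    funext π
    obtain ⟨σ, hσ⟩ := M.exists_consistent π
    rw [← M.mem_Opt_iff]
    by_contra ho
    have := M.mem_badLeaves.2 fun hs : M.Y σ ⊆ M.Opt => ho (hs hσ)
    rw [h] at this
    exact Finset.notMem_empty σ this
  rw [regret_eq, h0]
  simp only [expect_const, Finset.sum_const_zero]

/-- The main estimate for the contribution of a single terminal state. -/
theorem mul_threshold_add_le {G g n ℓ P : ℝ} (hg : 0 < g) (hg1 : g ≤ 1) (hgG : g ≤ G)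
    (hn : 1 ≤ n) (hP : P ≤ n) (hℓ : 69 / 100 ≤ ℓ) :
    G * (32 / 3 * (P + (n + 4) * ℓ) / g ^ 2 + 1) + 6 ≤ 100 * (n * G / g ^ 2 * ℓ) := by
  have hℓ0 : 0 < ℓ := by linarith
  have hn0 : 0 < n := by linarith
  have hG : 0 < G := hg.trans_le hgG
  have hnl : 1 * (69 / 100) ≤ n * ℓ := mul_le_mul hn hℓ (by norm_num) hn0.le
  have hnl' : n * (69 / 100) ≤ n * ℓ := mul_le_mul_of_nonneg_left hℓ hn0.le
  have hnl2 : 1 * ℓ ≤ n * ℓ := mul_le_mul_of_nonneg_right hn hℓ0.le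
  have hq : 1 ≤ G / g ^ 2 := by
    rw [le_div_iff₀ (by positivity)]
    nlinarith
  have hGq : G ≤ G / g ^ 2 := le_div_self hG.le (by positivity) (pow_le_one₀ hg.le hg1)
  have e : G * (32 / 3 * (P + (n + 4) * ℓ) / g ^ 2 + 1) =
      G / g ^ 2 * (32 / 3 * (P + (n + 4) * ℓ)) + G := by ring
  have e2 : 100 * (n * G / g ^ 2 * ℓ) = G / g ^ 2 * (100 * (n * ℓ)) := by ring
  rw [e, e2]
  -- The `7` collects the additive `6` and the lone `G`, using `1 ≤ G / g ^ 2` and `G ≤ G / g ^ 2`.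
  have h1 : G / g ^ 2 * (32 / 3 * (P + (n + 4) * ℓ) + 7) ≤ G / g ^ 2 * (100 * (n * ℓ)) := by
    refine mul_le_mul_of_nonneg_left ?_ (by positivity)
    linarith
  linarith

end Regret

end TreeMDP

/-! ### The regret bound. -/

open Classical in
theorem theorem3 :
    ∃ c : ℝ, 0 < c ∧
      ∀ (S : Type*) (L : Type*) (A : Type*) [Fintype S] [DecidableEq S] [Fintype L] [Fintype A]
        (M : TreeMDP S L A), (∀ σ, M.ret σ ∈ Set.Icc (0 : ℝ) 1) →
        ∀ alg : TreeMDP.Learner S L A, M.IsUcbT alg →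
          ∀ T : ℕ, 2 ≤ T →
            M.regret alg T ≤
              c * ∑ σ ∈ Finset.univ.filter (fun σ : L => ¬ M.Y σ ⊆ M.Opt),
                ((Fintype.card L : ℝ) * M.gapMax σ / M.gapMin σ ^ 2 * Real.log T +
                  Real.log (Fintype.card (TreeMDP.Policy S A))) := by
  refine ⟨100, by norm_num, ?_⟩
  intro S L A _ _ _ _ M hret alg halg T hT
  have hfilter : Finset.univ.filter (fun σ : L => ¬ M.Y σ ⊆ M.Opt) = M.badLeaves := by
    ext σ
    simp [M.mem_badLeaves]
  rw [hfilter]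
  rcases M.badLeaves.eq_empty_or_nonempty with hb | hb
  · rw [M.regret_eq_zero_of_badLeaves_eq_empty alg T hb, hb, Finset.sum_empty, mul_zero]
  obtain ⟨π, -⟩ := (alg 0 Fin.elim0).support_nonempty
  have : Nonempty A := ⟨π M.root⟩
  have : Nonempty L := ⟨hb.choose⟩
  set P := Real.log (Fintype.card (TreeMDP.Policy S A))
  set ℓ := Real.log T
  set n : ℝ := (Fintype.card L : ℝ) with hn
  have hn1 : 1 ≤ n := by
    rw [hn]
    exact_mod_cast Nat.one_le_iff_ne_zero.2 (Fintype.card_ne_zero (α := L))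
  have hP0 : 0 ≤ P := Real.log_natCast_nonneg _
  have hPn : P ≤ n := M.log_card_policy_le
  have hℓ : 69 / 100 ≤ ℓ := by
    have h1 : Real.log 2 ≤ ℓ := Real.log_le_log (by norm_num) (by exact_mod_cast hT)
    linarith [Real.log_two_gt_d9]
  -- The number of plays after which `σ` stops paying. Outside `badLeaves` the value is `0` by
  -- convention, and no such `σ` enters the sum.
  let θ : L → ℝ := fun σ => 32 / 3 * (P + (n + 4) * ℓ) / M.gapMin σ ^ 2
  have hθ : ∀ σ, 0 ≤ θ σ := fun σ => by
    have : 0 ≤ ℓ := by linarith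
    positivity
  refine (M.regret_le_charge hret alg halg T (fun σ => ⌊θ σ⌋₊ + 1)
    fun σ => (Nat.lt_floor_add_one (θ σ)).trans_eq (Nat.cast_succ _).symm).trans ?_
  -- The additive constant is spread over the bad leaves, of which there is at least one here.
  have hcard : (6 : ℝ) ≤ ∑ σ ∈ M.badLeaves, 6 := by
    rw [Finset.sum_const, nsmul_eq_mul]
    have : (1 : ℝ) ≤ M.badLeaves.card := by exact_mod_cast hb.card_pos
    linarith
  refine (add_le_add_right hcard _).trans ?_
  rw [← Finset.sum_add_distrib, Finset.mul_sum]
  refine Finset.sum_le_sum fun σ hσ => ?_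
  have hσ' := M.mem_badLeaves.1 hσ
  have h1 := TreeMDP.mul_threshold_add_le (M.gapMin_pos hσ') (M.gapMin_le_one hret hσ')
    (M.gapMin_le_gapMax hσ') hn1 hPn hℓ
  have h2 : M.gapMax σ * ((⌊θ σ⌋₊ + 1 : ℕ) : ℝ) ≤ M.gapMax σ * (θ σ + 1) := by
    refine mul_le_mul_of_nonneg_left ?_ (M.gapMax_nonneg σ)
    push_cast
    linarith [Nat.floor_le (hθ σ)]
  change M.gapMax σ * (θ σ + 1) + 6 ≤ _ at h1
  linarith
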